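/- For real $a$ with $-\pi<a<\pi$ put $$F(a)=\int_0^1\frac{\ln\ln(1/y)\,\sin a}{1+2y\cos a+y^2}\,dy .$$ Let $\psi=\Gamma'/\Gamma$ be the digamma function and $\gamma$ the Euler–Mascheroni constant. Then, for every $a\in(-\pi,\pi)$, the integral defining $F(a)$ and the integral below converge absolutely, $F$ is differentiable at $a$, and $$F'(a)=\int_0^1\frac{\ln\ln(1/y)\,\bigl((1+y^2)\cos a+2y\bigr)}{(1+2y\cos a+y^2)^2}\,dy=\frac{\ln(2\pi)}{2}+\frac14\,\psi\!\left(\frac12+\frac{a}{2\pi}\right)+\frac14\,\psi\!\left(\frac12-\frac{a}{2\pi}\right).$$ In particular (the case $a=\pi/2$), with an absolutely convergent integral, $$\int_0^1\frac{y\,\ln\ln(1/y)}{(1+y^2)^2}\,dy=\frac12\ln\sqrt{\pi}-\frac{\ln 4}{4}-\frac{\gamma}{4}.$$ -/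

import Mathlib

/-- `F(a) = ∫₀¹ ln ln(1/y) sin a / (1 + 2 y cos a + y²) dy`. -/
noncomputable def logLogF (a : ℝ) : ℝ :=
  ∫ y in (0 : ℝ)..1,
    Real.log (Real.log (1 / y)) * Real.sin a / (1 + 2 * y * Real.cos a + y ^ 2)

/-! Put `y = exp (-t)`, so that `log (log (1 / y))` becomes `log t`. Twice the integrand of `F'` is
then `log t` times the derivative of `K_a(t) = sinh t / (cosh t + cos a)`. Since `K_a` runs from 0
to 1, integration by parts needs the corrected primitive `P_a = K_a - 1 + exp (-t)`, which vanishes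
at both ends. With `∫ log t * exp (-t) = Γ'(1) = -γ` this gives `2 F'(a) = -γ - ∫ P_a(t) / t`
(`two_mul_integral_logLogF_deriv`).

The last integral is found by comparison with `a = 0`. The cotangent series expands `K_a(t) / t`
into terms `2 / (c ^ 2 + t ^ 2)`, each of integral `π / c`; the resulting series of reciprocals is a
combination of digamma values (`integral_inv_mul_poissonPrimitive_sub`). At `a = 0` a geometric
expansion and Frullani's integral turn the value into the logarithm of the Wallis product
(`integral_inv_mul_poissonPrimitive_zero`). The term `-γ` cancels against `ψ(1/2) = -2 log 2 - γ`.
The case `a = π / 2` uses the duplication formula to evaluate `ψ(1/4) + ψ(3/4)`. -/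

/-- The logarithmic derivative of the real Gamma function. -/
noncomputable def realDigamma (x : ℝ) : ℝ := deriv (Real.log ∘ Real.Gamma) x

/-! ### The real digamma function: difference series and special values. -/

theorem differentiableAt_Gamma_of_pos {x : ℝ} (hx : 0 < x) : DifferentiableAt ℝ Real.Gamma x :=
  Real.differentiableAt_Gamma fun m => ne_of_gt (by have := m.cast_nonneg (α := ℝ); linarith)

theorem differentiableAt_log_Gamma {x : ℝ} (hx : 0 < x) :
    DifferentiableAt ℝ (Real.log ∘ Real.Gamma) x :=
  (differentiableAt_Gamma_of_pos hx).log (Real.Gamma_pos_of_pos hx).ne'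

theorem digamma_ofReal {x : ℝ} (hx : 0 < x) : Complex.digamma (x : ℂ) = (realDigamma x : ℂ) := by
  have hd : DifferentiableAt ℂ Complex.Gamma (x : ℂ) := by
    refine Complex.differentiableAt_Gamma _ fun m h => ?_
    have h' : x = -(m : ℝ) := by exact_mod_cast h
    have := m.cast_nonneg (α := ℝ)
    linarith
  have h1 := hd.hasDerivAt.comp_ofReal
  have h2 := (differentiableAt_Gamma_of_pos hx).hasDerivAt.ofReal_comp
  simp only [Complex.Gamma_ofReal] at h1
  have h3 := h1.unique h2
  rw [realDigamma, Function.comp_def,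
    deriv.log (differentiableAt_Gamma_of_pos hx) (Real.Gamma_pos_of_pos hx).ne',
    Complex.digamma_def, logDeriv_apply, h3, Complex.Gamma_ofReal, Complex.ofReal_div]

theorem realDigamma_add_one {x : ℝ} (hx : 0 < x) : realDigamma (x + 1) = realDigamma x + 1 / x := by
  have h := Complex.digamma_apply_add_one (x : ℂ) (by
    intro m h
    have h' : x = -(m : ℝ) := by exact_mod_cast h
    have := m.cast_nonneg (α := ℝ)
    linarith)
  rw [digamma_ofReal hx, show ((x : ℂ) + 1) = ((x + 1 : ℝ) : ℂ) by push_cast; rfl,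
    digamma_ofReal (by linarith)] at h
  rw [one_div]
  exact_mod_cast h

theorem monotoneOn_realDigamma : MonotoneOn realDigamma (Set.Ioi 0) :=
  Real.convexOn_log_Gamma.monotoneOn_deriv fun _ hx => differentiableAt_log_Gamma hx

theorem realDigamma_add_nat {x : ℝ} (hx : 0 < x) (N : ℕ) :
    realDigamma (x + N) = realDigamma x + ∑ k ∈ Finset.range N, 1 / (x + k) := by
  induction N with
  | zero => simp
  | succ N ih =>
    rw [Finset.sum_range_succ, ← add_assoc, ← ih, Nat.cast_succ, ← add_assoc,
      realDigamma_add_one (by positivity)]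

/-- Log-convexity of Gamma makes digamma monotone, so the difference lies between 0 and the unit
increment `ψ(p + N + 1) - ψ(p + N) = 1 / (p + N)`. -/
theorem tendsto_realDigamma_sub {p q : ℝ} (hp : 0 < p) (hpq : p ≤ q) (hq : q ≤ p + 1) :
    Filter.Tendsto (fun N : ℕ => realDigamma (q + N) - realDigamma (p + N)) Filter.atTop
      (nhds 0) := by
  have h : Filter.Tendsto (fun N : ℕ => 1 / (p + N)) Filter.atTop (nhds 0) := by
    simp_rw [one_div]
    exact tendsto_inv_atTop_zero.comp
      (Filter.tendsto_atTop_add_const_left _ p tendsto_natCast_atTop_atTop)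
  refine tendsto_of_tendsto_of_tendsto_of_le_of_le tendsto_const_nhds h (fun N => ?_) (fun N => ?_)
  · have hN := N.cast_nonneg (α := ℝ)
    exact sub_nonneg.2 (monotoneOn_realDigamma (Set.mem_Ioi.2 (by linarith))
      (Set.mem_Ioi.2 (by linarith)) (by linarith))
  · have hN := N.cast_nonneg (α := ℝ)
    have h1 := realDigamma_add_one (x := p + N) (by linarith)
    have h2 := monotoneOn_realDigamma (a := q + N) (b := p + N + 1) (Set.mem_Ioi.2 (by linarith))
      (Set.mem_Ioi.2 (by linarith)) (by linarith)
    simp only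
    linarith

/-- The series of differences of the digamma function. -/
theorem tendsto_sum_realDigamma_sub {p q : ℝ} (hp : 0 < p) (hpq : p ≤ q) (hq : q ≤ p + 1) :
    Filter.Tendsto (fun N : ℕ => ∑ k ∈ Finset.range N, (1 / (p + k) - 1 / (q + k))) Filter.atTop
      (nhds (realDigamma q - realDigamma p)) := by
  have h := (tendsto_realDigamma_sub hp hpq hq).const_sub (realDigamma q - realDigamma p)
  rw [sub_zero] at h
  refine h.congr fun N => ?_
  rw [realDigamma_add_nat hp, realDigamma_add_nat (hp.trans_le hpq), Finset.sum_sub_distrib]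
  ring

theorem tendsto_sum_realDigamma_symm {x : ℝ} (h0 : 0 ≤ x) (h1 : x < 1 / 2) :
    Filter.Tendsto (fun N : ℕ => ∑ k ∈ Finset.range N, (1 / (1 / 2 + x + k) + 1 / (1 / 2 - x + k)
        - 2 * (1 / (1 / 2 + (k : ℝ))))) Filter.atTop
      (nhds (2 * realDigamma (1 / 2) - realDigamma (1 / 2 + x) - realDigamma (1 / 2 - x))) := by
  have hA := tendsto_sum_realDigamma_sub (p := 1 / 2) (q := 1 / 2 + x) (by norm_num)
    (by linarith) (by linarith)
  have hB := tendsto_sum_realDigamma_sub (p := 1 / 2 - x) (q := 1 / 2) (by linarith)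
    (by linarith) (by linarith)
  refine ((hB.sub hA).congr fun N => ?_).trans (le_of_eq ?_)
  · rw [← Finset.sum_sub_distrib]
    exact Finset.sum_congr rfl fun k _ => by ring
  · congr 1; ring

theorem realDigamma_one_half :
    realDigamma (1 / 2) = -2 * Real.log 2 - Real.eulerMascheroniConstant := by
  have h := digamma_ofReal (x := 1 / 2) (by norm_num)
  have h2 := Complex.digamma_one_half
  rw [show ((1 / 2 : ℝ) : ℂ) = 1 / 2 by push_cast; rfl, h2,
    show (2 : ℂ) = ((2 : ℝ) : ℂ) by norm_num, ← Complex.ofReal_log (by norm_num)] at h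
  exact_mod_cast h.symm

/-- This is the logarithmic derivative of Legendre's duplication formula at `s = 1 / 4`. -/
theorem realDigamma_one_quarter_add_three_quarters :
    realDigamma (3 / 4) + realDigamma (1 / 4)
      = -6 * Real.log 2 - 2 * Real.eulerMascheroniConstant := by
  have hL : ∀ {x : ℝ}, 0 < x → HasDerivAt (Real.log ∘ Real.Gamma) (realDigamma x) x := fun hx =>
    (differentiableAt_log_Gamma hx).hasDerivAt
  have h1 : HasDerivAt (fun s : ℝ => (Real.log ∘ Real.Gamma) s
      + (Real.log ∘ Real.Gamma) (s + 1 / 2)) (realDigamma (1 / 4) + realDigamma (3 / 4)) (1 / 4) := by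
    refine (hL (by norm_num)).add ?_
    have := HasDerivAt.comp_add_const (1 / 4 : ℝ) (1 / 2)
      (hL (x := 1 / 4 + 1 / 2) (by norm_num))
    rwa [show (1 / 4 + 1 / 2 : ℝ) = 3 / 4 by norm_num] at this
  have h2 : HasDerivAt (fun s : ℝ => (Real.log ∘ Real.Gamma) (2 * s)
      + (1 - 2 * s) * Real.log 2 + Real.log √Real.pi)
      (2 * realDigamma (1 / 2) + (-2) * Real.log 2) (1 / 4) := by
    have h3 : HasDerivAt (fun s : ℝ => 2 * s) 2 (1 / 4) := by
      simpa using (hasDerivAt_id (1 / 4 : ℝ)).const_mul 2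
    have h4 : HasDerivAt (fun s : ℝ => (Real.log ∘ Real.Gamma) (2 * s))
        (2 * realDigamma (1 / 2)) (1 / 4) := by
      have h5 := hL (x := 2 * (1 / 4)) (by norm_num)
      have := h5.comp (1 / 4 : ℝ) h3
      rw [show (2 * (1 / 4) : ℝ) = 1 / 2 by norm_num, mul_comm] at this
      exact this
    have h6 : HasDerivAt (fun s : ℝ => (1 - 2 * s) * Real.log 2) (-2 * Real.log 2) (1 / 4) := by
      simpa using ((h3.const_sub 1).mul_const (Real.log 2))
    exact (h4.add h6).add_const _
  have heq : (fun s : ℝ => (Real.log ∘ Real.Gamma) s + (Real.log ∘ Real.Gamma) (s + 1 / 2))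
      =ᶠ[nhds (1 / 4)] fun s : ℝ => (Real.log ∘ Real.Gamma) (2 * s)
        + (1 - 2 * s) * Real.log 2 + Real.log √Real.pi := by
    filter_upwards [lt_mem_nhds (show (0 : ℝ) < 1 / 4 by norm_num)] with s hs
    have hG : ∀ {x : ℝ}, 0 < x → Real.Gamma x ≠ 0 := fun hx => (Real.Gamma_pos_of_pos hx).ne'
    simp only [Function.comp_apply]
    rw [← Real.log_mul (hG hs) (hG (by linarith)), Real.Gamma_mul_Gamma_add_half,
      Real.log_mul (mul_ne_zero (hG (by linarith)) (by positivity)) (by positivity),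
      Real.log_mul (hG (by linarith)) (by positivity), Real.log_rpow (by norm_num)]
  have := (h1.congr_of_eventuallyEq heq.symm).unique h2
  rw [realDigamma_one_half] at this
  linarith

/-! ### Partial fractions of the Poisson kernel. -/

/-- The real part `1/2 + a/(2π)` is chosen so that `exp (2πiz) = -exp (-t) * exp (ia)`; the half
supplies the sign that turns the denominator into `1 + 2y cos a + y ^ 2`. -/
theorem cot_pi_mul_im (a t : ℝ) (ht : 0 < t) :
    (Complex.cot (Real.pi * (((1 / 2 + a / (2 * Real.pi) : ℝ) : ℂ)
      + ((t / (2 * Real.pi) : ℝ) : ℂ) * Complex.I))).im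
      = -((1 - Real.exp (-t) ^ 2) / (1 + 2 * Real.exp (-t) * Real.cos a + Real.exp (-t) ^ 2)) := by
  have hpi : (Real.pi : ℂ) ≠ 0 := by exact_mod_cast Real.pi_ne_zero
  rw [Complex.cot_pi_eq_exp_ratio]
  have hE : Complex.exp (2 * Real.pi * Complex.I * (((1 / 2 + a / (2 * Real.pi) : ℝ) : ℂ)
      + ((t / (2 * Real.pi) : ℝ) : ℂ) * Complex.I))
      = -((Real.exp (-t) : ℂ) * (Real.cos a + Real.sin a * Complex.I)) := by
    have : 2 * Real.pi * Complex.I * (((1 / 2 + a / (2 * Real.pi) : ℝ) : ℂ)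
      + ((t / (2 * Real.pi) : ℝ) : ℂ) * Complex.I)
      = Real.pi * Complex.I + ((-t : ℝ) : ℂ) + a * Complex.I := by
      push_cast
      field_simp
      linear_combination t * Complex.I_sq
    rw [this, Complex.exp_add, Complex.exp_add, Complex.exp_pi_mul_I, Complex.exp_mul_I,
      Complex.ofReal_exp, Complex.ofReal_cos, Complex.ofReal_sin]
    ring
  rw [hE]
  set y := Real.exp (-t)
  have hy : 0 < y := Real.exp_pos _
  have hy1 : y < 1 := by
    rw [← Real.exp_zero]; exact Real.exp_lt_exp.2 (by linarith)
  have hn : (1 + y * Real.cos a) ^ 2 + (y * Real.sin a) ^ 2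
      = 1 + 2 * y * Real.cos a + y ^ 2 := by
    linear_combination y ^ 2 * Real.sin_sq_add_cos_sq a
  have hD : 0 < 1 + 2 * y * Real.cos a + y ^ 2 := by
    nlinarith [Real.neg_one_le_cos a, mul_pos hy (sub_pos.2 hy1), sq_nonneg (1 - y)]
  rw [Complex.div_im]
  simp [Complex.normSq_apply, -Complex.ofReal_cos, -Complex.ofReal_sin]
  rw [show (y * Real.sin a * (y * Real.sin a) + (1 + y * Real.cos a) * (1 + y * Real.cos a))
    = 1 + 2 * y * Real.cos a + y ^ 2 by rw [← hn]; ring]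
  rw [← sub_div, ← neg_div]
  congr 1
  linear_combination y ^ 2 * Real.sin_sq_add_cos_sq a

theorem tendsto_div_sq_add (c τ : ℝ) :
    Filter.Tendsto (fun n : ℕ => τ / (((n : ℝ) + c) ^ 2 + τ ^ 2)) Filter.atTop (nhds 0) := by
  refine Filter.Tendsto.const_div_atTop ?_ _
  refine Filter.tendsto_atTop_add_const_right _ _ ?_
  exact (Filter.tendsto_pow_atTop two_ne_zero).comp
    (Filter.tendsto_atTop_add_const_right _ c tendsto_natCast_atTop_atTop)

/-- Partial fraction expansion of `sinh t / (cosh t + cos a)`. -/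
theorem hasSum_poisson_kernel {a t : ℝ} (ht : 0 < t) :
    HasSum (fun n : ℕ =>
      2 * t / ((2 * Real.pi * (1 / 2 + a / (2 * Real.pi) + n)) ^ 2 + t ^ 2)
      + 2 * t / ((2 * Real.pi * (1 / 2 - a / (2 * Real.pi) + n)) ^ 2 + t ^ 2))
      ((1 - Real.exp (-t) ^ 2) / (1 + 2 * Real.exp (-t) * Real.cos a + Real.exp (-t) ^ 2)) := by
  have hcot := cot_pi_mul_im a t ht
  set x := a / (2 * Real.pi)
  set τ := t / (2 * Real.pi) with hτ
  have hπ := Real.pi_pos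
  have hτ0 : 0 < τ := by positivity
  set z : ℂ := ((1 / 2 + x : ℝ) : ℂ) + (τ : ℂ) * Complex.I with hzdef
  have hzre : z.re = 1 / 2 + x := by simp [hzdef]
  have hzim : z.im = τ := by simp [hzdef]
  have hz : z ∈ Complex.integerComplement := by
    rintro ⟨m, hm⟩
    have := congrArg Complex.im hm
    rw [hzim] at this
    simp at this
    linarith
  have hs := (summable_cotTerm hz).hasSum
  simp only [cotTerm] at hs
  rw [← cot_series_rep' hz] at hs
  have hs' := Complex.hasSum_im hs
  have hinv : ∀ w : ℂ, w.im = τ → (1 / w).im = -(τ / (w.re ^ 2 + τ ^ 2)) := by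
    intro w hw
    rw [one_div, Complex.inv_im, Complex.normSq_apply, hw, neg_div]
    ring_nf
  have hterm : ∀ n : ℕ, (1 / (z - (n + 1)) + 1 / (z + (n + 1))).im
      = -(τ / (((n : ℝ) + (1 / 2 - x)) ^ 2 + τ ^ 2)
        + τ / ((((n + 1 : ℕ) : ℝ) + (1 / 2 + x)) ^ 2 + τ ^ 2)) := by
    intro n
    rw [Complex.add_im, hinv _ (by simp [hzim]), hinv _ (by simp [hzim])]
    simp only [Complex.sub_re, Complex.add_re, hzre, Complex.natCast_re, Complex.one_re]
    push_cast
    ring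
  simp_rw [hterm] at hs'
  rw [Complex.sub_im, hinv _ hzim, hzre, Complex.im_ofReal_mul, hcot] at hs'
  set G := (1 - Real.exp (-t) ^ 2) / (1 + 2 * Real.exp (-t) * Real.cos a + Real.exp (-t) ^ 2)
  have ht1 := hs'.neg.tendsto_sum_nat
  have hA := tendsto_div_sq_add (1 / 2 + x) τ
  set A : ℕ → ℝ := fun n => τ / (((n : ℝ) + (1 / 2 + x)) ^ 2 + τ ^ 2) with hAdef
  set B : ℕ → ℝ := fun n => τ / (((n : ℝ) + (1 / 2 - x)) ^ 2 + τ ^ 2) with hBdef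
  have hAB : HasSum (fun n => A n + B n) (Real.pi * G) := by
    rw [hasSum_iff_tendsto_nat_of_nonneg (fun n => by positivity)]
    -- The cotangent series pairs `B n` with `A (n + 1)` and keeps the pole term `A 0` apart.
    -- Re-pairing as `A n + B n` changes the `N`-th partial sum by the boundary term `A N`, which
    -- tends to 0.
    have h2 := (ht1.add_const (A 0)).sub hA
    refine (h2.congr fun N => ?_).trans (le_of_eq ?_)
    · simp only [neg_neg]
      have e1 : ∑ n ∈ Finset.range N, A (n + 1) = ∑ n ∈ Finset.range N, A n + A N - A 0 := by
        rw [← Finset.sum_range_succ, Finset.sum_range_succ']; ring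
      change ∑ n ∈ Finset.range N, (B n + A (n + 1)) + A 0 - A N = _
      rw [Finset.sum_add_distrib, Finset.sum_add_distrib, e1]
      ring
    · congr 1
      simp only [hAdef, Nat.cast_zero, zero_add]
      ring
  have hfin := hAB.mul_left (1 / Real.pi)
  rw [show 1 / Real.pi * (Real.pi * G) = G by field_simp] at hfin
  refine hfin.congr_fun fun n => ?_
  simp only [hAdef, hBdef]
  have ht' : t = 2 * Real.pi * τ := by rw [hτ]; field_simp
  rw [ht']
  have e : ∀ c : ℝ, 2 * (2 * Real.pi * τ) / ((2 * Real.pi * c) ^ 2 + (2 * Real.pi * τ) ^ 2)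
      = 1 / Real.pi * (τ / (c ^ 2 + τ ^ 2)) := by
    intro c
    have : 0 < c ^ 2 + τ ^ 2 := by positivity
    field_simp
  rw [e, e, mul_add]
  congr 4 <;> ring

/-! ### Denominator bounds, the substitution `y = exp (-t)`, and Euler's constant. -/

open MeasureTheory Filter Set Topology

theorem one_add_cos_pos {a : ℝ} (h1 : -Real.pi < a) (h2 : a < Real.pi) : 0 < 1 + Real.cos a := by
  have h : Real.cos Real.pi < Real.cos |a| :=
    Real.cos_lt_cos_of_nonneg_of_le_pi (abs_nonneg a) le_rfl (abs_lt.2 ⟨h1, h2⟩)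
  rw [Real.cos_pi, Real.cos_abs] at h
  linarith

/-- The denominator equals `(1 + cos a) / 2 * (1 + y) ^ 2 + (1 - cos a) / 2 * (1 - y) ^ 2`. The
bound is uniform in `y`, as dominated differentiation requires. -/
theorem poisson_denom_ge (a : ℝ) {y : ℝ} (hy : 0 ≤ y) :
    (1 + Real.cos a) / 2 ≤ 1 + 2 * y * Real.cos a + y ^ 2 := by
  have h1 := mul_nonneg (neg_le_iff_add_nonneg'.1 (Real.neg_one_le_cos a))
    (show 0 ≤ (1 + y) ^ 2 - 1 by nlinarith)
  have h2 := mul_nonneg (sub_nonneg.2 (Real.cos_le_one a)) (sq_nonneg (1 - y))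
  nlinarith

theorem poisson_denom_pos {a : ℝ} (h1 : -Real.pi < a) (h2 : a < Real.pi) {y : ℝ} (hy : 0 ≤ y) :
    0 < 1 + 2 * y * Real.cos a + y ^ 2 :=
  lt_of_lt_of_le (by linarith [one_add_cos_pos h1 h2]) (poisson_denom_ge a hy)

theorem image_exp_neg_Ioi : (fun t : ℝ => Real.exp (-t)) '' Ioi 0 = Ioo 0 1 := by
  ext y
  constructor
  · rintro ⟨t, ht, rfl⟩
    refine ⟨Real.exp_pos _, ?_⟩
    rw [← Real.exp_zero]
    exact Real.exp_lt_exp.2 (neg_lt_zero.2 ht)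
  · rintro ⟨h0, h1⟩
    exact ⟨-Real.log y, neg_pos.2 (Real.log_neg h0 h1), by simp [Real.exp_log h0]⟩

theorem hasDerivAt_exp_neg (t : ℝ) :
    HasDerivAt (fun t : ℝ => Real.exp (-t)) (-Real.exp (-t)) t := by
  simpa using (hasDerivAt_neg t).exp

theorem injOn_exp_neg (s : Set ℝ) : InjOn (fun t : ℝ => Real.exp (-t)) s := fun _ _ _ _ h =>
  neg_injective (Real.exp_injective h)

theorem intervalIntegrable_iff_exp_neg (g : ℝ → ℝ) : IntervalIntegrable g volume 0 1 ↔
    IntegrableOn (fun t => Real.exp (-t) * g (Real.exp (-t))) (Ioi 0) := by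
  rw [intervalIntegrable_iff_integrableOn_Ioo_of_le zero_le_one, ← image_exp_neg_Ioi,
    integrableOn_image_iff_integrableOn_abs_deriv_smul measurableSet_Ioi
      (fun t _ => (hasDerivAt_exp_neg t).hasDerivWithinAt) (injOn_exp_neg _)]
  simp [abs_of_pos (Real.exp_pos _)]

theorem intervalIntegral_eq_exp_neg (g : ℝ → ℝ) : ∫ y in (0 : ℝ)..1, g y =
    ∫ t in Ioi 0, Real.exp (-t) * g (Real.exp (-t)) := by
  rw [intervalIntegral.integral_of_le zero_le_one, integral_Ioc_eq_integral_Ioo,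
    ← image_exp_neg_Ioi, integral_image_eq_integral_abs_deriv_smul measurableSet_Ioi
      (fun t _ => (hasDerivAt_exp_neg t).hasDerivWithinAt) (injOn_exp_neg _)]
  simp [abs_of_pos (Real.exp_pos _)]

theorem log_log_one_div_exp_neg (t : ℝ) : Real.log (Real.log (1 / Real.exp (-t))) = Real.log t := by
  simp

theorem integrableOn_log_mul_exp_neg :
    IntegrableOn (fun t => Real.log t * Real.exp (-t)) (Ioi 0) := by
  rw [← Ioc_union_Ioi_eq_Ioi zero_le_one]
  refine IntegrableOn.union ?_ ?_
  · have h : IntervalIntegrable Real.log volume 0 1 := intervalIntegral.intervalIntegrable_log'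
    exact (intervalIntegrable_iff_integrableOn_Ioc_of_le zero_le_one).1
      (h.mul_continuousOn (by fun_prop))
  · have h : IntegrableOn (fun t : ℝ => Real.exp (-t) * t ^ ((2 : ℝ) - 1)) (Ioi 1) :=
      (Real.GammaIntegral_convergent (by norm_num)).mono_set (Ioi_subset_Ioi zero_le_one)
    refine Integrable.mono' h ?_ ?_
    · exact (Real.measurable_log.mul (by fun_prop)).aestronglyMeasurable
    · refine (ae_restrict_iff' measurableSet_Ioi).2 (ae_of_all _ fun t ht => ?_)
      have ht' : (1 : ℝ) < t := ht
      rw [norm_mul, Real.norm_of_nonneg (Real.log_nonneg ht'.le),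
        Real.norm_of_nonneg (Real.exp_pos _).le, mul_comm]
      refine mul_le_mul_of_nonneg_left ?_ (Real.exp_pos _).le
      norm_num
      linarith [Real.log_le_sub_one_of_pos (show 0 < t by linarith)]

/-- Differentiating Euler's integral under the integral sign at `s = 1` identifies this with
`Γ'(1)`. -/
theorem integral_log_mul_exp_neg :
    ∫ t in Ioi (0 : ℝ), Real.log t * Real.exp (-t) = -Real.eulerMascheroniConstant := by
  have h1 := Complex.hasDerivAt_GammaIntegral (s := 1) (by simp)
  have heq : Complex.Gamma =ᶠ[𝓝 1] Complex.GammaIntegral := by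
    filter_upwards [(isOpen_lt continuous_const Complex.continuous_re).mem_nhds
      (show (0 : ℝ) < (1 : ℂ).re by simp)] with s hs
    exact Complex.Gamma_eq_integral hs
  have h2 := (h1.congr_of_eventuallyEq heq).unique Complex.hasDerivAt_Gamma_one
  simp only [sub_self, Complex.cpow_zero, one_mul] at h2
  rw [← Complex.ofReal_inj, ← integral_complex_ofReal, Complex.ofReal_neg, ← h2]
  simp

/-! ### Integrability and differentiation under the integral sign. -/

theorem intervalIntegrable_log_log :
    IntervalIntegrable (fun y : ℝ => Real.log (Real.log (1 / y))) volume 0 1 := by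
  rw [intervalIntegrable_iff_exp_neg]
  simp only [log_log_one_div_exp_neg]
  simpa only [mul_comm] using integrableOn_log_mul_exp_neg

theorem intervalIntegrable_log_log_mul {g : ℝ → ℝ} (hg : ContinuousOn g (Icc 0 1)) :
    IntervalIntegrable (fun y : ℝ => Real.log (Real.log (1 / y)) * g y) volume 0 1 :=
  intervalIntegrable_log_log.mul_continuousOn (by rwa [uIcc_of_le zero_le_one])

theorem continuousOn_poisson {a : ℝ} (h1 : -Real.pi < a) (h2 : a < Real.pi) :
    ContinuousOn (fun y : ℝ => Real.sin a / (1 + 2 * y * Real.cos a + y ^ 2)) (Icc 0 1) :=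
  ContinuousOn.div (by fun_prop) (by fun_prop) fun _ hy => (poisson_denom_pos h1 h2 hy.1).ne'

theorem continuousOn_poisson_deriv {a : ℝ} (h1 : -Real.pi < a) (h2 : a < Real.pi) :
    ContinuousOn (fun y : ℝ => ((1 + y ^ 2) * Real.cos a + 2 * y) /
      (1 + 2 * y * Real.cos a + y ^ 2) ^ 2) (Icc 0 1) :=
  ContinuousOn.div (by fun_prop) (by fun_prop) fun _ hy =>
    pow_ne_zero _ (poisson_denom_pos h1 h2 hy.1).ne'

theorem intervalIntegrable_logLogF {a : ℝ} (h1 : -Real.pi < a) (h2 : a < Real.pi) :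
    IntervalIntegrable (fun y : ℝ => Real.log (Real.log (1 / y)) * Real.sin a /
      (1 + 2 * y * Real.cos a + y ^ 2)) volume 0 1 := by
  simp only [mul_div_assoc]
  exact intervalIntegrable_log_log_mul (continuousOn_poisson h1 h2)

theorem intervalIntegrable_logLogF_deriv {a : ℝ} (h1 : -Real.pi < a) (h2 : a < Real.pi) :
    IntervalIntegrable (fun y : ℝ => Real.log (Real.log (1 / y)) *
      ((1 + y ^ 2) * Real.cos a + 2 * y) / (1 + 2 * y * Real.cos a + y ^ 2) ^ 2) volume 0 1 := by
  simp only [mul_div_assoc]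
  exact intervalIntegrable_log_log_mul (continuousOn_poisson_deriv h1 h2)

theorem hasDerivAt_logLogF {a : ℝ} (h1 : -Real.pi < a) (h2 : a < Real.pi) :
    HasDerivAt logLogF (∫ y in (0 : ℝ)..1, Real.log (Real.log (1 / y)) *
      ((1 + y ^ 2) * Real.cos a + 2 * y) / (1 + 2 * y * Real.cos a + y ^ 2) ^ 2) a := by
  -- Half of the lower bound for the denominator at `a`, so that `m` still bounds it from below for
  -- all `b` near `a`.
  set m := (1 + Real.cos a) / 4 with hm
  have hc := one_add_cos_pos h1 h2
  have hm0 : 0 < m := by rw [hm]; linarith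
  have hs : {b : ℝ | m < (1 + Real.cos b) / 2} ∈ 𝓝 a := by
    refine IsOpen.mem_nhds (isOpen_lt continuous_const (by fun_prop)) ?_
    change m < (1 + Real.cos a) / 2
    linarith
  have hD : ∀ {b y : ℝ}, m < (1 + Real.cos b) / 2 → 0 ≤ y →
      m < 1 + 2 * y * Real.cos b + y ^ 2 := fun hb hy => hb.trans_le (poisson_denom_ge _ hy)
  refine (intervalIntegral.hasDerivAt_integral_of_dominated_loc_of_deriv_le
    (F' := fun b y => Real.log (Real.log (1 / y)) *
      ((1 + y ^ 2) * Real.cos b + 2 * y) / (1 + 2 * y * Real.cos b + y ^ 2) ^ 2)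
    (bound := fun y => |Real.log (Real.log (1 / y))| * (4 / m ^ 2)) hs ?_
    (intervalIntegrable_logLogF h1 h2)
    (intervalIntegrable_logLogF_deriv h1 h2).aestronglyMeasurable_restrict_uIoc ?_
    (intervalIntegrable_log_log.abs.mul_const _) ?_).2
  · refine Eventually.of_forall fun b => Measurable.aestronglyMeasurable ?_
    fun_prop
  · refine ae_of_all _ fun y hy b hb => ?_
    rw [uIoc_of_le zero_le_one] at hy
    have hDb := hD hb hy.1.le
    rw [mul_div_assoc, norm_mul, Real.norm_eq_abs]
    refine mul_le_mul_of_nonneg_left ?_ (abs_nonneg _)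
    rw [norm_div, Real.norm_eq_abs, Real.norm_of_nonneg (sq_nonneg _)]
    refine div_le_div₀ (by norm_num) ?_ (by positivity) (pow_le_pow_left₀ hm0.le hDb.le 2)
    have hy2 : y ^ 2 ≤ 1 := pow_le_one₀ hy.1.le hy.2
    have hcos := abs_le.1 (Real.abs_cos_le_one b)
    rw [abs_le]
    constructor <;> nlinarith [hy.1, hy.2, sq_nonneg y]
  · refine ae_of_all _ fun y hy b hb => ?_
    rw [uIoc_of_le zero_le_one] at hy
    have hDb := hm0.trans (hD hb hy.1.le)
    have hn := (Real.hasDerivAt_sin b).const_mul (Real.log (Real.log (1 / y)))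
    have hd := (((Real.hasDerivAt_cos b).const_mul (2 * y)).const_add 1).add_const (y ^ 2)
    refine (hn.div hd hDb.ne').congr_deriv ?_
    congr 1
    linear_combination (2 * y * Real.log (Real.log (1 / y))) * Real.sin_sq_add_cos_sq b

/-! ### Integration by parts. -/

/-- The antiderivative `sinh t / (cosh t + cos a)` corrected by `e⁻ᵗ - 1` so that it vanishes at
`0` and at `∞`. -/
noncomputable def poissonPrimitive (a t : ℝ) : ℝ :=
  (1 - Real.exp (-t) ^ 2) / (1 + 2 * Real.exp (-t) * Real.cos a + Real.exp (-t) ^ 2)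
    - 1 + Real.exp (-t)

theorem hasDerivAt_poissonPrimitive {a : ℝ} (h1 : -Real.pi < a) (h2 : a < Real.pi) (t : ℝ) :
    HasDerivAt (poissonPrimitive a) (Real.exp (-t) *
      (2 * (((1 + Real.exp (-t) ^ 2) * Real.cos a + 2 * Real.exp (-t)) /
        (1 + 2 * Real.exp (-t) * Real.cos a + Real.exp (-t) ^ 2) ^ 2) - 1)) t := by
  have hD := poisson_denom_pos h1 h2 (Real.exp_pos (-t)).le
  have he := hasDerivAt_exp_neg t
  have hn := (he.pow 2).const_sub 1
  have hd := (((he.const_mul 2).mul_const (Real.cos a)).const_add 1).add (he.pow 2)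
  refine (((hn.div hd hD.ne').sub_const 1).add he).congr_deriv ?_
  simp only [Pi.add_apply, Pi.pow_apply]
  field_simp
  push_cast
  ring

/-- With `y = exp (-t)`, the primitive factors as `(1 - y) * y` times a bounded quotient, and `1 - y
≤ t`. The factor `t` controls `1 / t` and `log t` at 0; the factor `exp (-t)` handles infinity. -/
theorem abs_poissonPrimitive_le {a : ℝ} (h1 : -Real.pi < a) (h2 : a < Real.pi) {t : ℝ}
    (ht : 0 ≤ t) : |poissonPrimitive a t| ≤ 8 / (1 + Real.cos a) * (t * Real.exp (-t)) := by
  have hc := one_add_cos_pos h1 h2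
  have hD := poisson_denom_pos h1 h2 (Real.exp_pos (-t)).le
  have hDge := poisson_denom_ge a (Real.exp_pos (-t)).le
  have ht1 : 1 - Real.exp (-t) ≤ t := by linarith [Real.add_one_le_exp (-t)]
  have hy1 : Real.exp (-t) ≤ 1 := Real.exp_le_one_iff.2 (by linarith)
  have hy0 := Real.exp_pos (-t)
  have hcos := abs_le.1 (Real.abs_cos_le_one a)
  rw [poissonPrimitive]
  set y := Real.exp (-t)
  have e : (1 - y ^ 2) / (1 + 2 * y * Real.cos a + y ^ 2) - 1 + y
      = (1 - y) * y * ((1 - 2 * Real.cos a - y) / (1 + 2 * y * Real.cos a + y ^ 2)) := by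
    generalize hE : 1 + 2 * y * Real.cos a + y ^ 2 = E at hD
    field_simp
    rw [← hE]
    ring
  have hq : |(1 - 2 * Real.cos a - y) / (1 + 2 * y * Real.cos a + y ^ 2)|
      ≤ 8 / (1 + Real.cos a) := by
    rw [abs_div, abs_of_pos hD]
    calc _ ≤ 4 / ((1 + Real.cos a) / 2) :=
          div_le_div₀ (by norm_num) (abs_le.2 ⟨by linarith, by linarith⟩) (by linarith) hDge
      _ = _ := by field_simp; norm_num
  rw [e, abs_mul, abs_of_nonneg (mul_nonneg (by linarith) hy0.le), mul_comm]
  gcongr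

theorem continuous_poissonPrimitive {a : ℝ} (h1 : -Real.pi < a) (h2 : a < Real.pi) :
    Continuous (poissonPrimitive a) :=
  continuous_iff_continuousAt.2 fun t => (hasDerivAt_poissonPrimitive h1 h2 t).continuousAt

theorem integrableOn_inv_mul_poissonPrimitive {a : ℝ} (h1 : -Real.pi < a) (h2 : a < Real.pi) :
    IntegrableOn (fun t => t⁻¹ * poissonPrimitive a t) (Ioi 0) := by
  have h : IntegrableOn (fun t : ℝ => 8 / (1 + Real.cos a) * Real.exp (-t)) (Ioi 0) :=
    (integrableOn_exp_neg_Ioi 0).const_mul _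
  refine Integrable.mono' h ?_ ((ae_restrict_iff' measurableSet_Ioi).2 (ae_of_all _ fun t ht => ?_))
  · exact (measurable_inv.mul
      (continuous_poissonPrimitive h1 h2).measurable).aestronglyMeasurable
  · have ht' : (0 : ℝ) < t := ht
    rw [norm_mul, Real.norm_of_nonneg (inv_pos.2 ht').le, Real.norm_eq_abs]
    calc _ ≤ t⁻¹ * (8 / (1 + Real.cos a) * (t * Real.exp (-t))) :=
          mul_le_mul_of_nonneg_left (abs_poissonPrimitive_le h1 h2 ht'.le) (inv_pos.2 ht').le
      _ = _ := by field_simp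

/-- Integration by parts for the derivative of `logLogF`. -/
theorem two_mul_integral_logLogF_deriv {a : ℝ} (h1 : -Real.pi < a) (h2 : a < Real.pi) :
    2 * (∫ y in (0 : ℝ)..1, Real.log (Real.log (1 / y)) *
      ((1 + y ^ 2) * Real.cos a + 2 * y) / (1 + 2 * y * Real.cos a + y ^ 2) ^ 2)
      = -Real.eulerMascheroniConstant - ∫ t in Ioi 0, t⁻¹ * poissonPrimitive a t := by
  have hint := intervalIntegrable_logLogF_deriv h1 h2
  have hgI := intervalIntegrable_log_log_mul (g := fun y => 2 * (((1 + y ^ 2) * Real.cos a + 2 * y)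
      / (1 + 2 * y * Real.cos a + y ^ 2) ^ 2) - 1)
    (((continuousOn_poisson_deriv h1 h2).const_mul 2).sub continuousOn_const)
  have hgI' := (intervalIntegrable_iff_exp_neg _).1 hgI
  simp only [log_log_one_div_exp_neg] at hgI'
  have hc := one_add_cos_pos h1 h2
  have hparts := integral_Ioi_mul_deriv_eq_deriv_mul (a := 0) (a' := 0) (b' := 0) (u := Real.log)
    (u' := fun t => t⁻¹) (v := poissonPrimitive a)
    (fun t ht => Real.hasDerivAt_log (ne_of_gt ht))
    (fun t _ => hasDerivAt_poissonPrimitive h1 h2 t)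
    (hgI'.congr_fun (fun t _ => by simp only [Pi.mul_apply]; ring) measurableSet_Ioi)
    (integrableOn_inv_mul_poissonPrimitive h1 h2) ?_ ?_
  · have hγ : ∫ y in (0 : ℝ)..1, Real.log (Real.log (1 / y)) = -Real.eulerMascheroniConstant := by
      rw [intervalIntegral_eq_exp_neg, ← integral_log_mul_exp_neg]
      simp only [log_log_one_div_exp_neg, mul_comm]
    have hL : ∫ y in (0 : ℝ)..1, Real.log (Real.log (1 / y)) *
        (2 * (((1 + y ^ 2) * Real.cos a + 2 * y) / (1 + 2 * y * Real.cos a + y ^ 2) ^ 2) - 1)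
        = -∫ t in Ioi 0, t⁻¹ * poissonPrimitive a t := by
      rw [intervalIntegral_eq_exp_neg]
      simp only [log_log_one_div_exp_neg]
      rw [sub_self, zero_sub] at hparts
      rw [← hparts]
      exact setIntegral_congr_fun measurableSet_Ioi fun t _ => by ring
    -- The `-1` in the integrand of `hL` comes from the correction `exp (-t)`; adding the plain
    -- log-log integral, which is `-γ`, removes it.
    rw [← hγ, sub_eq_add_neg, ← hL, ← intervalIntegral.integral_const_mul,
      ← intervalIntegral.integral_add intervalIntegrable_log_log hgI]
    refine intervalIntegral.integral_congr fun y _ => ?_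
    ring
  · have hlim : Tendsto (fun t : ℝ => 8 / (1 + Real.cos a) * |Real.log t * t|) (𝓝[>] 0) (𝓝 0) := by
      have := (tendsto_log_mul_rpow_nhdsGT_zero one_pos).abs.const_mul (8 / (1 + Real.cos a))
      simpa using this
    refine squeeze_zero_norm' ?_ hlim
    filter_upwards [self_mem_nhdsWithin] with t ht
    have ht' : (0 : ℝ) < t := ht
    have hb := abs_poissonPrimitive_le h1 h2 ht'.le
    have hy1 : Real.exp (-t) ≤ 1 := Real.exp_le_one_iff.2 (by linarith)
    rw [Pi.mul_apply, norm_mul, Real.norm_eq_abs, Real.norm_eq_abs, abs_mul, abs_of_pos ht']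
    calc _ ≤ |Real.log t| * (8 / (1 + Real.cos a) * (t * 1)) := by
          refine mul_le_mul_of_nonneg_left (hb.trans ?_) (abs_nonneg _)
          gcongr
      _ = _ := by ring
  · have hlim : Tendsto (fun t : ℝ => 8 / (1 + Real.cos a) * (t ^ 2 * Real.exp (-t)))
        atTop (𝓝 0) := by
      have := (Real.tendsto_pow_mul_exp_neg_atTop_nhds_zero 2).const_mul (8 / (1 + Real.cos a))
      simpa using this
    refine squeeze_zero_norm' ?_ hlim
    filter_upwards [eventually_ge_atTop 1] with t ht
    have ht' : (0 : ℝ) < t := by linarith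
    have hb := abs_poissonPrimitive_le h1 h2 ht'.le
    have hl0 := Real.log_nonneg ht
    have hlt : Real.log t ≤ t := by linarith [Real.log_le_sub_one_of_pos ht']
    rw [Pi.mul_apply, norm_mul, Real.norm_of_nonneg hl0, Real.norm_eq_abs]
    calc _ ≤ t * (8 / (1 + Real.cos a) * (t * Real.exp (-t))) :=
          mul_le_mul hlt hb (abs_nonneg _) ht'.le
      _ = _ := by ring

/-! ### Frullani integrals and the value at `a = 0`. -/

theorem integrableOn_frullani_exp {p q : ℝ} (hp : 0 < p) (hpq : p ≤ q) :
    IntegrableOn (fun t : ℝ => t⁻¹ * (Real.exp (-(p * t)) - Real.exp (-(q * t)))) (Ioi 0) := by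
  have h : IntegrableOn (fun t : ℝ => (q - p) * Real.exp (-p * t)) (Ioi 0) :=
    (integrableOn_exp_mul_Ioi (neg_lt_zero.2 hp) 0).const_mul _
  refine Integrable.mono' h ?_ ((ae_restrict_iff' measurableSet_Ioi).2 (ae_of_all _ fun t ht => ?_))
  · exact Measurable.aestronglyMeasurable (by fun_prop)
  · have ht' : (0 : ℝ) < t := ht
    have e : Real.exp (-(q * t)) = Real.exp (-(p * t)) * Real.exp (-((q - p) * t)) := by
      rw [← Real.exp_add]; ring_nf
    have h3 := Real.add_one_le_exp (-((q - p) * t))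
    have h4 : Real.exp (-((q - p) * t)) ≤ 1 :=
      Real.exp_le_one_iff.2 (by nlinarith)
    rw [norm_mul, Real.norm_of_nonneg (inv_pos.2 ht').le, e, neg_mul,
      show Real.exp (-(p * t)) - Real.exp (-(p * t)) * Real.exp (-((q - p) * t))
        = Real.exp (-(p * t)) * (1 - Real.exp (-((q - p) * t))) by ring,
      Real.norm_of_nonneg (mul_nonneg (Real.exp_pos _).le (by linarith))]
    calc _ ≤ t⁻¹ * (Real.exp (-(p * t)) * ((q - p) * t)) := by
          gcongr; linarith
      _ = _ := by field_simp

theorem integral_frullani_exp {p q : ℝ} (hp : 0 < p) (hpq : p ≤ q) :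
    ∫ t in Ioi (0 : ℝ), t⁻¹ * (Real.exp (-(p * t)) - Real.exp (-(q * t))) = Real.log (q / p) := by
  have hcont : Continuous fun t : ℝ => Real.exp (-t) := by fun_prop
  have := Frullani.integral_Ioi_eq (f := fun t : ℝ => Real.exp (-t)) (L := 1) (R := 0)
    (hcont.locallyIntegrable.locallyIntegrableOn _) hp (hp.trans_le hpq)
    (by simpa using (hcont.tendsto 0).mono_left nhdsWithin_le_nhds)
    Real.tendsto_exp_neg_atTop_nhds_zero (integrableOn_frullani_exp hp hpq)
  simpa using this

/-- The value of the integral at `a = 0`, by the Wallis product. -/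
theorem integral_inv_mul_poissonPrimitive_zero :
    ∫ t in Ioi 0, t⁻¹ * poissonPrimitive 0 t = -Real.log (Real.pi / 2) := by
  -- For `a = 0` the primitive is `-y * (1 - y) ^ 2 / (1 - y ^ 2)`. These are the terms of its
  -- geometric series, with sign reversed and divided by `t`: nonnegative, and each a difference of
  -- two Frullani integrands whose logarithms combine to a Wallis factor.
  set f : ℕ → ℝ → ℝ := fun n t =>
    t⁻¹ * (Real.exp (-((2 * n + 1) * t)) - Real.exp (-((2 * n + 2) * t)))
    - t⁻¹ * (Real.exp (-((2 * n + 2) * t)) - Real.exp (-((2 * n + 3) * t))) with hf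
  have hi1 : ∀ n : ℕ, IntegrableOn (fun t : ℝ => t⁻¹ * (Real.exp (-((2 * n + 1) * t))
      - Real.exp (-((2 * n + 2) * t)))) (Ioi 0) := fun n =>
    integrableOn_frullani_exp (by positivity) (by linarith)
  have hi2 : ∀ n : ℕ, IntegrableOn (fun t : ℝ => t⁻¹ * (Real.exp (-((2 * n + 2) * t))
      - Real.exp (-((2 * n + 3) * t)))) (Ioi 0) := fun n =>
    integrableOn_frullani_exp (by positivity) (by linarith)
  have hfint : ∀ n, ∫ t in Ioi 0, f n t
      = Real.log ((2 * n + 2) / (2 * n + 1) * ((2 * n + 2) / (2 * n + 3))) := by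
    intro n
    have hn := n.cast_nonneg (α := ℝ)
    rw [hf, integral_sub (hi1 n) (hi2 n), integral_frullani_exp (by positivity) (by linarith),
      integral_frullani_exp (by positivity) (by linarith), ← Real.log_div (by positivity)
      (by positivity)]
    congr 1
    field_simp
  have hform : ∀ n t, f n t = t⁻¹ * (Real.exp (-t) * (1 - Real.exp (-t)) ^ 2)
      * (Real.exp (-t) ^ 2) ^ n := by
    intro n t
    have e1 : Real.exp (-((2 * n + 1) * t)) = (Real.exp (-t) ^ 2) ^ n * Real.exp (-t) := by
      rw [← pow_mul, ← Real.exp_nat_mul, ← Real.exp_add]; push_cast; ring_nf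
    have e2 : Real.exp (-((2 * n + 2) * t)) = (Real.exp (-t) ^ 2) ^ n * Real.exp (-t) ^ 2 := by
      rw [← pow_mul, ← Real.exp_nat_mul, ← Real.exp_nat_mul, ← Real.exp_add]; push_cast; ring_nf
    have e3 : Real.exp (-((2 * n + 3) * t)) = (Real.exp (-t) ^ 2) ^ n * Real.exp (-t) ^ 3 := by
      rw [← pow_mul, ← Real.exp_nat_mul, ← Real.exp_nat_mul, ← Real.exp_add]; push_cast; ring_nf
    simp only [hf]
    rw [e1, e2, e3]
    ring
  have hnonneg : ∀ n, ∀ t ∈ Ioi (0 : ℝ), 0 ≤ f n t := by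
    intro n t ht
    have ht' : (0 : ℝ) < t := ht
    rw [hform]
    positivity
  have hnorm : ∀ n, ∫ t in Ioi 0, ‖f n t‖ = ∫ t in Ioi 0, f n t := fun n =>
    setIntegral_congr_fun measurableSet_Ioi fun t ht => Real.norm_of_nonneg (hnonneg n t ht)
  have hwallis : HasSum (fun n => ∫ t in Ioi 0, f n t) (Real.log (Real.pi / 2)) := by
    rw [hasSum_iff_tendsto_nat_of_nonneg fun n =>
      setIntegral_nonneg measurableSet_Ioi (hnonneg n)]
    refine (Real.tendsto_prod_pi_div_two.log (by positivity)).congr fun N => ?_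
    rw [Real.log_prod fun n _ => by positivity]
    exact Finset.sum_congr rfl fun n _ => (hfint n).symm
  have hsum := hasSum_integral_of_summable_integral_norm (μ := volume.restrict (Ioi 0)) (F := f)
    (fun n => (hi1 n).sub (hi2 n)) (by simp_rw [hnorm]; exact hwallis.summable)
  rw [hwallis.unique hsum, ← integral_neg]
  refine setIntegral_congr_fun measurableSet_Ioi fun t ht => ?_
  have ht' : (0 : ℝ) < t := ht
  have hy1 : Real.exp (-t) < 1 := by
    rw [← Real.exp_zero]; exact Real.exp_lt_exp.2 (by linarith)
  have hy0 := Real.exp_pos (-t)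
  simp only [hform]
  rw [tsum_mul_left, tsum_geometric_of_lt_one (by positivity) (pow_lt_one₀ hy0.le hy1 two_ne_zero),
    poissonPrimitive, Real.cos_zero]
  set y := Real.exp (-t)
  have e1 : (1 - y ^ 2) = (1 - y) * (1 + y) := by ring
  have e2 : 1 + 2 * y * 1 + y ^ 2 = (1 + y) ^ 2 := by ring
  have e3 : 1 - y ≠ 0 := by linarith
  rw [e1, e2]
  field_simp
  ring

/-! ### Comparison of general `a` with `a = 0`. -/

theorem hasDerivAt_arctan_div {c : ℝ} (hc : 0 < c) (t : ℝ) :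
    HasDerivAt (fun t => 2 / c * Real.arctan (t / c)) (2 / (c ^ 2 + t ^ 2)) t := by
  refine ((((hasDerivAt_id t).div_const c).arctan).const_mul (2 / c)).congr_deriv ?_
  simp only [id]
  field_simp

theorem tendsto_arctan_div {c : ℝ} (hc : 0 < c) :
    Tendsto (fun t => 2 / c * Real.arctan (t / c)) atTop (𝓝 (Real.pi / c)) := by
  have h := ((Real.tendsto_arctan_atTop.mono_right nhdsWithin_le_nhds).comp
    (tendsto_id.atTop_div_const hc)).const_mul (2 / c)
  rwa [show 2 / c * (Real.pi / 2) = Real.pi / c by field_simp] at h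

theorem integrableOn_two_div_sq_add_sq {c : ℝ} (hc : 0 < c) :
    IntegrableOn (fun t : ℝ => 2 / (c ^ 2 + t ^ 2)) (Ioi 0) :=
  integrableOn_Ioi_deriv_of_nonneg' (fun t _ => hasDerivAt_arctan_div hc t)
    (fun t _ => by positivity) (tendsto_arctan_div hc)

theorem integral_two_div_sq_add_sq {c : ℝ} (hc : 0 < c) :
    ∫ t in Ioi (0 : ℝ), 2 / (c ^ 2 + t ^ 2) = Real.pi / c := by
  rw [integral_Ioi_of_hasDerivAt_of_nonneg' (fun t _ => hasDerivAt_arctan_div hc t)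
    (fun t _ => by positivity) (tendsto_arctan_div hc)]
  simp

/-- The correction `exp (-t) - 1` cancels in the difference, leaving two partial fraction series to
integrate term by term. Subtracting the case `a = 0` is essential: the integrals `π / c` of one
series alone have a divergent sum. -/
theorem integral_inv_mul_poissonPrimitive_sub {a : ℝ} (h0 : 0 ≤ a) (h2 : a < Real.pi) :
    (∫ t in Ioi 0, t⁻¹ * poissonPrimitive a t) - ∫ t in Ioi 0, t⁻¹ * poissonPrimitive 0 t
      = realDigamma (1 / 2) - realDigamma (1 / 2 + a / (2 * Real.pi)) / 2
        - realDigamma (1 / 2 - a / (2 * Real.pi)) / 2 := by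
  have hpi := Real.pi_pos
  have hx0 : 0 ≤ a / (2 * Real.pi) := by positivity
  have hx1 : a / (2 * Real.pi) < 1 / 2 := by rw [div_lt_div_iff₀ (by positivity) two_pos]; linarith
  have hI := integrableOn_inv_mul_poissonPrimitive (a := a) (by linarith) h2
  have hI0 := integrableOn_inv_mul_poissonPrimitive (a := 0) (by linarith) hpi
  have hkernel : ∀ t ∈ Ioi (0 : ℝ), HasSum (fun n : ℕ =>
      2 / ((2 * Real.pi * (1 / 2 + a / (2 * Real.pi) + n)) ^ 2 + t ^ 2)
      + 2 / ((2 * Real.pi * (1 / 2 - a / (2 * Real.pi) + n)) ^ 2 + t ^ 2)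
      - 2 * (2 / ((2 * Real.pi * (1 / 2 + n)) ^ 2 + t ^ 2)))
      (t⁻¹ * poissonPrimitive a t - t⁻¹ * poissonPrimitive 0 t) := by
    intro t ht
    have ht' : (0 : ℝ) < t := ht
    have h := ((hasSum_poisson_kernel (a := a) ht').sub
      (hasSum_poisson_kernel (a := 0) ht')).mul_left t⁻¹
    simp only [zero_div, add_zero, sub_zero] at h
    rw [← mul_sub, poissonPrimitive, poissonPrimitive, sub_add, sub_add, sub_sub_sub_cancel_right]
    refine h.congr_fun fun n => ?_
    have e : ∀ c : ℝ, 2 * t / (c ^ 2 + t ^ 2) = t * (2 / (c ^ 2 + t ^ 2)) := fun c => by ring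
    rw [e, e, e]
    field_simp
    ring
  generalize a / (2 * Real.pi) = x at hx0 hx1 hkernel
  have hα : ∀ n : ℕ, 0 < 2 * Real.pi * (1 / 2 + x + n) := fun n => by positivity
  have hβ : ∀ n : ℕ, 0 < 2 * Real.pi * (1 / 2 - x + n) := fun n => by
    have : 0 < 1 / 2 - x := by linarith
    positivity
  have hδ : ∀ n : ℕ, 0 < 2 * Real.pi * (1 / 2 + (n : ℝ)) := fun n => by positivity
  set f : ℕ → ℝ → ℝ := fun n t => 2 / ((2 * Real.pi * (1 / 2 + x + n)) ^ 2 + t ^ 2)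
      + 2 / ((2 * Real.pi * (1 / 2 - x + n)) ^ 2 + t ^ 2)
      - 2 * (2 / ((2 * Real.pi * (1 / 2 + n)) ^ 2 + t ^ 2)) with hf
  have hiα := fun n => integrableOn_two_div_sq_add_sq (hα n)
  have hiβ := fun n => integrableOn_two_div_sq_add_sq (hβ n)
  have hiδ := fun n => integrableOn_two_div_sq_add_sq (hδ n)
  have hfi : ∀ n, IntegrableOn (f n) (Ioi 0) := fun n =>
    ((hiα n).add (hiβ n)).sub ((hiδ n).const_mul 2)
  have e : ∀ c : ℝ, Real.pi / (2 * Real.pi * c) = 1 / 2 * (1 / c) := fun c => by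
    rw [mul_comm 2 Real.pi, mul_assoc, div_mul_eq_div_div, div_self hpi.ne', one_div_mul_one_div]
  have hfint : ∀ n, ∫ t in Ioi 0, f n t = 1 / 2 * (1 / (1 / 2 + x + n) + 1 / (1 / 2 - x + n)
      - 2 * (1 / (1 / 2 + (n : ℝ)))) := by
    intro n
    refine (integral_sub ((hiα n).add (hiβ n)) ((hiδ n).const_mul 2)).trans ?_
    rw [integral_add' (hiα n) (hiβ n), integral_const_mul, integral_two_div_sq_add_sq (hα n),
      integral_two_div_sq_add_sq (hβ n), integral_two_div_sq_add_sq (hδ n), e, e, e]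
    ring
  have hbound : ∀ n, ∫ t in Ioi 0, ‖f n t‖
      ≤ 1 / 2 * (1 / (1 / 2 - x + n) - 1 / (1 / 2 + x + n)) := by
    intro n
    -- As `0 ≤ x`, the three kernels are ordered as `A ≤ D ≤ B`, for the shifts `1/2 + x`, `1/2`,
    -- `1/2 - x`, whence `|A + B - 2 D| ≤ B - A`. The integrals of `B - A` form a convergent digamma
    -- difference series.
    have hle : ∫ t in Ioi 0, ‖f n t‖ ≤ ∫ t in Ioi 0,
        (2 / ((2 * Real.pi * (1 / 2 - x + n)) ^ 2 + t ^ 2)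
          - 2 / ((2 * Real.pi * (1 / 2 + x + n)) ^ 2 + t ^ 2)) := by
      refine setIntegral_mono_on (hfi n).norm ((hiβ n).sub (hiα n)) measurableSet_Ioi fun t _ => ?_
      have hA : 2 / ((2 * Real.pi * (1 / 2 + x + n)) ^ 2 + t ^ 2)
          ≤ 2 / ((2 * Real.pi * (1 / 2 + n)) ^ 2 + t ^ 2) := by
        have := hδ n
        gcongr
        linarith
      have hB : 2 / ((2 * Real.pi * (1 / 2 + n)) ^ 2 + t ^ 2)
          ≤ 2 / ((2 * Real.pi * (1 / 2 - x + n)) ^ 2 + t ^ 2) := by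
        have := hβ n
        gcongr
        linarith
      rw [Real.norm_eq_abs, abs_le]
      simp only [hf]
      constructor <;> linarith
    rw [integral_sub (hiβ n) (hiα n), integral_two_div_sq_add_sq (hα n),
      integral_two_div_sq_add_sq (hβ n), e, e, ← mul_sub] at hle
    exact hle
  have hmaj : Summable fun n : ℕ => 1 / (1 / 2 - x + n) - 1 / (1 / 2 + x + n) := by
    refine (hasSum_iff_tendsto_nat_of_nonneg (fun n => ?_) _).2 (tendsto_sum_realDigamma_sub
      (p := 1 / 2 - x) (q := 1 / 2 + x) (by linarith) (by linarith) (by linarith)) |>.summable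
    have : 0 < 1 / 2 - x + n := add_pos_of_pos_of_nonneg (by linarith) n.cast_nonneg
    rw [sub_nonneg]
    gcongr
    linarith
  have hsummable : Summable fun n => ∫ t in Ioi 0, ‖f n t‖ :=
    Summable.of_nonneg_of_le (fun n => integral_nonneg fun t => norm_nonneg _) hbound
      (hmaj.mul_left _)
  have hsum := hasSum_integral_of_summable_integral_norm (μ := volume.restrict (Ioi 0)) (F := f)
    hfi hsummable
  have hlim := (tendsto_sum_realDigamma_symm hx0 hx1).const_mul (1 / 2)
  have hlim' := hsum.tendsto_sum_nat
  simp_rw [hfint, ← Finset.mul_sum] at hlim'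
  have hval := tendsto_nhds_unique hlim' hlim
  rw [setIntegral_congr_fun measurableSet_Ioi (fun t ht => (hkernel t ht).tsum_eq),
    integral_sub hI hI0] at hval
  rw [hval]
  ring

/-! ### Closed form and conclusion. -/

theorem integral_logLogF_deriv_of_nonneg {a : ℝ} (h0 : 0 ≤ a) (h2 : a < Real.pi) :
    (∫ y in (0 : ℝ)..1, Real.log (Real.log (1 / y)) *
      ((1 + y ^ 2) * Real.cos a + 2 * y) / (1 + 2 * y * Real.cos a + y ^ 2) ^ 2)
      = Real.log (2 * Real.pi) / 2 + 1 / 4 * realDigamma (1 / 2 + a / (2 * Real.pi))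
        + 1 / 4 * realDigamma (1 / 2 - a / (2 * Real.pi)) := by
  have hpi := Real.pi_pos
  have h := two_mul_integral_logLogF_deriv (a := a) (by linarith) h2
  have hd := integral_inv_mul_poissonPrimitive_sub h0 h2
  rw [integral_inv_mul_poissonPrimitive_zero, realDigamma_one_half,
    Real.log_div hpi.ne' two_ne_zero] at hd
  rw [Real.log_mul two_ne_zero hpi.ne']
  linarith

theorem integral_logLogF_deriv {a : ℝ} (h1 : -Real.pi < a) (h2 : a < Real.pi) :
    (∫ y in (0 : ℝ)..1, Real.log (Real.log (1 / y)) *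
      ((1 + y ^ 2) * Real.cos a + 2 * y) / (1 + 2 * y * Real.cos a + y ^ 2) ^ 2)
      = Real.log (2 * Real.pi) / 2 + 1 / 4 * realDigamma (1 / 2 + a / (2 * Real.pi))
        + 1 / 4 * realDigamma (1 / 2 - a / (2 * Real.pi)) := by
  rcases le_total 0 a with h | h
  · exact integral_logLogF_deriv_of_nonneg h h2
  -- Both sides are even in `a`.
  · have := integral_logLogF_deriv_of_nonneg (a := -a) (by linarith) (by linarith)
    rw [Real.cos_neg, neg_div, sub_neg_eq_add, ← sub_eq_add_neg] at this
    rw [this]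
    ring

theorem mainTheorem6 :
    (∀ a : ℝ, -Real.pi < a → a < Real.pi →
      IntervalIntegrable
        (fun y : ℝ => Real.log (Real.log (1 / y)) * Real.sin a /
          (1 + 2 * y * Real.cos a + y ^ 2)) MeasureTheory.volume 0 1 ∧
      IntervalIntegrable
        (fun y : ℝ => Real.log (Real.log (1 / y)) * ((1 + y ^ 2) * Real.cos a + 2 * y) /
          (1 + 2 * y * Real.cos a + y ^ 2) ^ 2) MeasureTheory.volume 0 1 ∧
      HasDerivAt logLogF
        (∫ y in (0 : ℝ)..1,
          Real.log (Real.log (1 / y)) * ((1 + y ^ 2) * Real.cos a + 2 * y) /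
            (1 + 2 * y * Real.cos a + y ^ 2) ^ 2) a ∧
      ((∫ y in (0 : ℝ)..1,
          Real.log (Real.log (1 / y)) * ((1 + y ^ 2) * Real.cos a + 2 * y) /
            (1 + 2 * y * Real.cos a + y ^ 2) ^ 2 : ℝ) : ℂ) =
        (Real.log (2 * Real.pi) : ℂ) / 2
          + 1 / 4 * Complex.digamma (1 / 2 + (a : ℂ) / (2 * (Real.pi : ℂ)))
          + 1 / 4 * Complex.digamma (1 / 2 - (a : ℂ) / (2 * (Real.pi : ℂ)))) ∧
    IntervalIntegrable
      (fun y : ℝ => y * Real.log (Real.log (1 / y)) / (1 + y ^ 2) ^ 2)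
      MeasureTheory.volume 0 1 ∧
    (∫ y in (0 : ℝ)..1, y * Real.log (Real.log (1 / y)) / (1 + y ^ 2) ^ 2) =
      1 / 2 * Real.log (Real.sqrt Real.pi) - Real.log 4 / 4
        - Real.eulerMascheroniConstant / 4 := by
  have hpi := Real.pi_pos
  have hpt : ∀ y : ℝ, Real.log (Real.log (1 / y)) * ((1 + y ^ 2) * Real.cos (Real.pi / 2) + 2 * y) /
      (1 + 2 * y * Real.cos (Real.pi / 2) + y ^ 2) ^ 2
      = 2 * (y * Real.log (Real.log (1 / y)) / (1 + y ^ 2) ^ 2) := by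
    intro y
    rw [Real.cos_pi_div_two]
    simp only [mul_zero, zero_add, add_zero]
    ring
  refine ⟨fun a h1 h2 => ⟨intervalIntegrable_logLogF h1 h2, intervalIntegrable_logLogF_deriv h1 h2,
    hasDerivAt_logLogF h1 h2, ?_⟩, ?_, ?_⟩
  · have hx1 : a / (2 * Real.pi) < 1 / 2 := by
      rw [div_lt_div_iff₀ (by positivity) two_pos]; linarith
    have hx2 : -(1 / 2) < a / (2 * Real.pi) := by
      rw [← neg_div, div_lt_div_iff₀ two_pos (by positivity)]; linarith
    rw [integral_logLogF_deriv h1 h2]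
    push_cast
    rw [← digamma_ofReal (by linarith), ← digamma_ofReal (by linarith)]
    push_cast
    rfl
  · have h := intervalIntegrable_logLogF_deriv (a := Real.pi / 2) (by linarith) (by linarith)
    simp only [hpt] at h
    simpa using h.const_mul (1 / 2)
  · have h := integral_logLogF_deriv (a := Real.pi / 2) (by linarith) (by linarith)
    simp only [hpt] at h
    have hq := realDigamma_one_quarter_add_three_quarters
    rw [intervalIntegral.integral_const_mul,
      show Real.pi / 2 / (2 * Real.pi) = 1 / 4 by field_simp; norm_num,
      show (1 / 2 + 1 / 4 : ℝ) = 3 / 4 by norm_num, show (1 / 2 - 1 / 4 : ℝ) = 1 / 4 by norm_num,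
      Real.log_mul two_ne_zero hpi.ne'] at h
    rw [Real.log_sqrt hpi.le, show (4 : ℝ) = 2 ^ 2 by norm_num, Real.log_pow]
    push_cast
    linarith
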